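/- Let $X$ and $Y$ be real Hilbert spaces and let $X\times Y$ carry the Hilbert product structure $\langle (x,y),(x',y')\rangle=\langle x,x'\rangle+\langle y,y'\rangle$. Let $L\colon X\to Y$ be a nonzero bounded linear operator with adjoint $L^*$. Let $\sigma>0$ and let $f\colon X\to\left]-\infty,+\infty\right]$ be proper, lower semicontinuous and $\sigma$-strongly convex. Let $\beta>0$ and let $g\colon Y\to\mathbb R$ be convex and differentiable with $\beta$-Lipschitz continuous gradient $\nabla g$. Denote by $\partial$ the convex subdifferential and by $g^*(v)=\sup_{y\in Y}\{\langle v,y\rangle-g(y)\}$ the convex conjugate of $g$, and define $$\mathbf A\colon X\times Y\to X\times Y\colon (x,y)\mapsto (L^*y,-Lx),\qquad \mathbf B\colon X\times Y\rightrightarrows X\times Y\colon (x,y)\mapsto \partial f(x)\times\partial g^*(y).$$ Then the resolvents $J_{\mathbf A}=(\mathrm{Id}+\mathbf A)^{-1}$ and $J_{\mathbf B}=(\mathrm{Id}+\mathbf B)^{-1}$ are single-valued and defined on all of $X\times Y$. Put $R_{\mathbf A}=2J_{\mathbf A}-\mathrm{Id}$, $R_{\mathbf B}=2J_{\mathbf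 B}-\mathrm{Id}$, $$T=\tfrac12(\mathrm{Id}+R_{\mathbf B}R_{\mathbf A}),\qquad \widetilde T=\tfrac12(\mathrm{Id}+R_{\mathbf A}R_{\mathbf B}),$$ $\mu=\min\{\sigma,1/\beta\}$ and $$r=\frac{1}{2(1+\mu)}\left(\sqrt{2\mu^2+2\mu+1+2\Bigl(1-\frac{2}{1+\|L\|^2}\Bigr)\mu(1+\mu)}+1\right).$$ Then $0<r<1$, and there exist $\bar{\mathbf x},\hat{\mathbf x}\in X\times Y$ such that $$\operatorname{Fix}T=\operatorname{Fix}R_{\mathbf B}R_{\mathbf A}=\{\bar{\mathbf x}\},\qquad \operatorname{Fix}\widetilde T=\operatorname{Fix}R_{\mathbf A}R_{\mathbf B}=\{\hat{\mathbf x}\},$$ $$\{z\in X\times Y : 0\in \mathbf Az+\mathbf Bz\}=\{J_{\mathbf A}\bar{\mathbf x}\}=\{J_{\mathbf B}\hat{\mathbf x}\}.$$ Moreover, for every $\mathbf x_0\in X\times Y$, the following sequences converge strongly with linear rate $r$, for all $n\in\mathbb N$: 1. $T^n\mathbf x_0\to\bar{\mathbf x}$, with $\|T^n\mathbf x_0-\bar{\mathbf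 x}\|\le r^n\|\mathbf x_0-\bar{\mathbf x}\|$; 2. $J_{\mathbf A}T^n\mathbf x_0\to J_{\mathbf A}\bar{\mathbf x}$, with $\|J_{\mathbf A}T^n\mathbf x_0-J_{\mathbf A}\bar{\mathbf x}\|\le r^n\|\mathbf x_0-\bar{\mathbf x}\|$; 3. $\widetilde T^n\mathbf x_0\to\hat{\mathbf x}$, with $\|\widetilde T^n\mathbf x_0-\hat{\mathbf x}\|\le r^n\|\mathbf x_0-\hat{\mathbf x}\|$; 4. $J_{\mathbf B}\widetilde T^n\mathbf x_0\to J_{\mathbf B}\hat{\mathbf x}$, with $\|J_{\mathbf B}\widetilde T^n\mathbf x_0-J_{\mathbf B}\hat{\mathbf x}\|\le r^n\|\mathbf x_0-\hat{\mathbf x}\|$. -/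

import Mathlib

open Filter Topology

namespace PrimalDualDR

section Convex

variable {H : Type*} [NormedAddCommGroup H] [InnerProductSpace ℝ H]

/-- An extended-real-valued function is proper if it never takes the value `-∞` and is finite
somewhere. -/
def IsProper (f : H → EReal) : Prop :=
  (∀ x, f x ≠ ⊥) ∧ ∃ x, f x ≠ ⊤

/-- `σ`-strong convexity of a function with values in `(-∞, +∞]`:
`f (t x + (1 - t) y) + (σ / 2) t (1 - t) ‖x - y‖² ≤ t f x + (1 - t) f y` for `0 < t < 1`. -/
def IsStronglyConvex (σ : ℝ) (f : H → EReal) : Prop :=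
  ∀ x y : H, ∀ t : ℝ, 0 < t → t < 1 →
    f (t • x + (1 - t) • y) + ((σ / 2 * (t * (1 - t)) * ‖x - y‖ ^ 2 : ℝ) : EReal)
      ≤ (t : EReal) * f x + ((1 - t : ℝ) : EReal) * f y

/-- The convex (Fenchel) conjugate `f* u = sup_x (⟨u, x⟩ - f x)`. -/
noncomputable def conjugate (f : H → EReal) (u : H) : EReal :=
  ⨆ x : H, ((inner ℝ u x : ℝ) : EReal) - f x

/-- The convex subdifferential `∂f x = {u | ∀ y, f x + ⟨u, y - x⟩ ≤ f y}`. -/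
def subdifferential (f : H → EReal) (x : H) : Set H :=
  {u | ∀ y : H, f x + ((inner ℝ u (y - x) : ℝ) : EReal) ≤ f y}

end Convex

section Operators

variable {H : Type*} [NormedAddCommGroup H] [InnerProductSpace ℝ H]

/-- The resolvent `(Id + A)⁻¹` of a set-valued operator, as a set-valued operator: `u` belongs to
its value at `x` exactly when `x ∈ u + A u`. -/
def resolvent (A : H → Set H) (x : H) : Set H :=
  {u | ∃ v ∈ A u, u + v = x}

/-- The zeros of the sum of two set-valued operators: `0 ∈ A z + B z`. -/
def zerSum (A B : H → Set H) : Set H :=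
  {z | ∃ a ∈ A z, ∃ b ∈ B z, a + b = 0}

/-- The reflected resolvent `2 J - Id` attached to a (single-valued) resolvent `J`. -/
def reflected (J : H → H) (x : H) : H :=
  (2 : ℝ) • J x - x

/-- The Douglas–Rachford operator `(1/2) (Id + R S)`. -/
noncomputable def drOperator (R S : H → H) (x : H) : H :=
  (1 / 2 : ℝ) • (x + R (S x))

/-- `u` converges strongly to `l`, with `‖u n - l‖ ≤ C r ^ n` for all `n`. -/
def ConvergesLinearly (u : ℕ → H) (l : H) (r C : ℝ) : Prop :=
  Tendsto u atTop (𝓝 l) ∧ ∀ n, ‖u n - l‖ ≤ C * r ^ n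

end Operators

section PrimalDual

variable {X Y : Type*} [NormedAddCommGroup X] [InnerProductSpace ℝ X] [CompleteSpace X]
  [NormedAddCommGroup Y] [InnerProductSpace ℝ Y] [CompleteSpace Y]

/-- The operator `(x, y) ↦ (L* y, -L x)` on the Hilbert space `X × Y`, as a set-valued operator
with singleton values. -/
noncomputable def opA (L : X →L[ℝ] Y) (z : WithLp 2 (X × Y)) : Set (WithLp 2 (X × Y)) :=
  {WithLp.toLp 2 (ContinuousLinearMap.adjoint L z.snd, -(L z.fst))}

/-- The operator `(x, y) ↦ ∂f x × ∂g* y` on the Hilbert space `X × Y`. -/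
def opB (f : X → EReal) (g : Y → ℝ) (z : WithLp 2 (X × Y)) : Set (WithLp 2 (X × Y)) :=
  {w | w.fst ∈ subdifferential f z.fst ∧
    w.snd ∈ subdifferential (conjugate fun y => (g y : EReal)) z.snd}

end PrimalDual

/-- The convergence rate
`r = (√(2μ² + 2μ + 1 + 2 (1 - 2 (1 + ℓ²)⁻¹) μ (1 + μ)) + 1) / (2 (1 + μ))`. -/
noncomputable def rate (ℓ μ : ℝ) : ℝ :=
  1 / (2 * (1 + μ)) *
    (Real.sqrt (2 * μ ^ 2 + 2 * μ + 1 + 2 * (1 - 2 * (1 + ℓ ^ 2)⁻¹) * μ * (1 + μ)) + 1)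

end PrimalDualDR

/-!
On `X × Y` the operator `A (x, y) = (L* y, -L x)` is skew, so its resolvent `J_A` exists
(`Id + A` is coercive) and its reflection `R_A` is the Cayley transform `(Id - A) (Id + A)⁻¹`, a
linear isometry. The bound `‖A‖ ≤ ‖L‖` keeps the angle between `x` and `R_A x` away from `π`:
`⟪x, R_A x⟫ ≥ -(1 - 2 / (1 + ‖L‖²)) ‖x‖²`. The operator `B` is `μ`-strongly monotone, so differences
of values of `2 J_B` lie in the ball centered at `u / (1 + μ)` of radius `‖u‖ / (1 + μ)`, where `u`
is the difference of the arguments. The triangle inequality then makes `½ (Id + R_B R_A)` a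
contraction with constant exactly `r` (`norm_half_add_reflection_le`). Transporting by the isometry
`R_A` gives the same constant for `½ (Id + R_A R_B)`, and Banach's fixed point theorem does the rest
(`douglasRachford_linear_convergence`).

Two facts about `B` have to be supplied.

* Its resolvent is everywhere defined. A closed convex epigraph lies above a downward cone, so
  adding `½ ‖· - z‖²` makes the function bounded below; minimizing sequences are Cauchy by the
  parallelogram law (`exists_prox_of_isClosed_convex`). This is applied to `f` and to `g`; the
  resolvent of `∂g*` is `∇g` composed with the proximal map of `g`.
* `∂g*` is `1/β`-strongly monotone. By the Baillon–Haddad theorem `∇g` is `1/β`-cocoercive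
  (`ConvexOn.gradient_cocoercive`), and `∂g*` is the inverse of `∇g`. The inclusion of `∂g*` in that
  inverse does not need the Fenchel–Moreau theorem: the inverse of `∇g` is contained in the monotone
  operator `∂g*` and already has an everywhere defined resolvent
  (`ConvexOn.gradient_eq_of_mem_subdifferential_conjugate`).
-/

namespace PrimalDualDR

/-! ### Proximal points from closed convex epigraphs -/

section Prox

variable {H : Type*} [NormedAddCommGroup H] [InnerProductSpace ℝ H]

/-- If `b + τ a ≥ 0` for all small `τ > 0`, then `b ≥ 0`. -/
lemma nonneg_of_forall_add_mul_nonneg {a b : ℝ}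
    (h : ∀ τ : ℝ, 0 < τ → τ < 1 → 0 ≤ b + τ * a) : 0 ≤ b := by
  have ht : Tendsto (fun τ : ℝ => b + τ * a) (𝓝[>] 0) (𝓝 (b + 0 * a)) :=
    ((continuous_const.add (continuous_id.mul continuous_const)).tendsto 0).mono_left
      nhdsWithin_le_nhds
  rw [zero_mul, add_zero] at ht
  refine ge_of_tendsto ht ?_
  filter_upwards [Ioo_mem_nhdsGT (zero_lt_one' ℝ)] with τ hτ using h τ hτ.1 hτ.2

/-- The substitute for an affine minorant: a closed convex set in `H × ℝ` missing a point straight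
below one of its own points lies above a downward cone. -/
lemma exists_forall_ge_of_isClosed_convex {E : Set (H × ℝ)} (hE : IsClosed E) (hc : Convex ℝ E)
    {x₀ : H} {s₀ : ℝ} (h₀ : (x₀, s₀) ∈ E) (h₁ : (x₀, s₀ - 1) ∉ E) :
    ∃ K : ℝ, 0 ≤ K ∧ ∀ q ∈ E, s₀ - 1 - K * ‖q.1 - x₀‖ ≤ q.2 := by
  obtain ⟨ε, hε, hball⟩ := Metric.isOpen_iff.1 hE.isOpen_compl _ h₁
  refine ⟨1 / ε, by positivity, ?_⟩
  rintro ⟨y, t⟩ hy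
  by_contra! hlt
  simp only at hlt
  have hK : 0 ≤ 1 / ε * ‖y - x₀‖ := by positivity
  have hd : 1 < s₀ - t := by linarith
  -- the segment from `(x₀, s₀)` to `(y, t)` crosses the height `s₀ - 1` at parameter `τ`
  set τ : ℝ := 1 / (s₀ - t) with hτ
  have hτ0 : 0 < τ := by rw [hτ]; exact one_div_pos.2 (by linarith)
  have hτ1 : τ ≤ 1 := by rw [hτ, div_le_one (by linarith)]; exact hd.le
  have hτm : τ * (s₀ - t) = 1 := by rw [hτ]; field_simp
  have hmem : (x₀ + τ • (y - x₀), s₀ - 1) ∈ E := by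
    have := hc h₀ hy (sub_nonneg.2 hτ1) hτ0.le (by ring)
    convert this using 1
    ext
    · simp only [Prod.smul_mk, Prod.mk_add_mk]; module
    · simp only [Prod.smul_mk, Prod.mk_add_mk, smul_eq_mul]; linarith
  have hnot : ¬ dist (x₀ + τ • (y - x₀), s₀ - 1) (x₀, s₀ - 1) < ε := fun h => hball h hmem
  apply hnot
  rw [Prod.dist_eq, dist_self, dist_eq_norm, add_sub_cancel_left, norm_smul,
    Real.norm_of_nonneg hτ0.le]
  refine max_lt ?_ hε
  have h2 : 1 / ε * ‖y - x₀‖ < s₀ - t := by linarith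
  have h3 : ‖y - x₀‖ < ε * (s₀ - t) := by
    rw [one_div, inv_mul_lt_iff₀ hε] at h2; exact h2
  calc τ * ‖y - x₀‖ < τ * (ε * (s₀ - t)) := by gcongr
    _ = ε * (τ * (s₀ - t)) := by ring
    _ = ε := by rw [hτm, mul_one]

/-- Existence of proximal points: a closed convex set in `H × ℝ`, thought of as the epigraph of a
function `F`, has a point `(p, s)` at which `z - p` is a subgradient. The point minimizes
`s + ‖p - z‖² / 2`. -/
lemma exists_prox_of_isClosed_convex [CompleteSpace H] {E : Set (H × ℝ)} (hE : IsClosed E)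
    (hc : Convex ℝ E) {x₀ : H} {s₀ : ℝ} (h₀ : (x₀, s₀) ∈ E) (h₁ : (x₀, s₀ - 1) ∉ E) (z : H) :
    ∃ q ∈ E, ∀ w ∈ E, q.2 + inner ℝ (z - q.1) (w.1 - q.1) ≤ w.2 := by
  obtain ⟨K, hK, hlow⟩ := exists_forall_ge_of_isClosed_convex hE hc h₀ h₁
  set φ : H × ℝ → ℝ := fun q => q.2 + 1 / 2 * ‖q.1 - z‖ ^ 2 with hφ
  have hbdd : BddBelow (φ '' E) := by
    refine ⟨s₀ - 1 - K * ‖z - x₀‖ - K ^ 2 / 2, ?_⟩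
    rintro _ ⟨q, hq, rfl⟩
    have h1 := hlow q hq
    have h2 : ‖q.1 - x₀‖ ≤ ‖q.1 - z‖ + ‖z - x₀‖ := norm_sub_le_norm_sub_add_norm_sub _ _ _
    have h3 := mul_le_mul_of_nonneg_left h2 hK
    simp only [hφ]
    nlinarith [sq_nonneg (‖q.1 - z‖ - K)]
  have hne : (φ '' E).Nonempty := ⟨_, _, h₀, rfl⟩
  set m := sInf (φ '' E) with hm
  have hmin : ∀ q ∈ E, m ≤ φ q := fun q hq => csInf_le hbdd ⟨q, hq, rfl⟩
  have hseq : ∀ n : ℕ, ∃ q ∈ E, φ q < m + 1 / ((n : ℝ) + 1) := by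
    intro n
    have hpos : (0 : ℝ) < 1 / ((n : ℝ) + 1) := by positivity
    obtain ⟨_, ⟨q, hq, rfl⟩, hlt⟩ := exists_lt_of_csInf_lt hne (lt_add_of_pos_right m hpos)
    exact ⟨q, hq, hlt⟩
  choose q hqE hqlt using hseq
  -- evaluating `φ` at midpoints, the parallelogram law bounds the distance of near-minimizers
  have hpar : ∀ a ∈ E, ∀ b ∈ E, ‖a.1 - b.1‖ ^ 2 ≤ 4 * (φ a + φ b - 2 * m) := by
    intro a ha b hb
    have hmid := hmin _ (hc ha hb (by norm_num : (0 : ℝ) ≤ 1 / 2) (by norm_num : (0 : ℝ) ≤ 1 / 2)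
      (by norm_num))
    simp only [hφ, Prod.fst_add, Prod.snd_add, Prod.smul_fst, Prod.smul_snd, smul_eq_mul] at hmid ⊢
    have e1 : (1 / 2 : ℝ) • a.1 + (1 / 2 : ℝ) • b.1 - z
        = (1 / 2 : ℝ) • ((a.1 - z) + (b.1 - z)) := by module
    rw [e1, norm_smul, mul_pow] at hmid
    have e2 := parallelogram_law_with_norm ℝ (a.1 - z) (b.1 - z)
    rw [sub_sub_sub_cancel_right] at e2
    norm_num at hmid
    nlinarith
  have hcau : CauchySeq fun n => (q n).1 := by
    refine Metric.cauchySeq_iff'.2 fun ε hε => ?_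
    obtain ⟨N, hN⟩ := exists_nat_one_div_lt (show (0 : ℝ) < ε ^ 2 / 8 by positivity)
    refine ⟨N, fun n hn => ?_⟩
    rw [dist_eq_norm]
    have h1 := hpar _ (hqE n) _ (hqE N)
    have h2 := hqlt n
    have h3 := hqlt N
    have h4 : 1 / ((n : ℝ) + 1) ≤ 1 / ((N : ℝ) + 1) := by
      have : (N : ℝ) ≤ n := by exact_mod_cast hn
      gcongr
    exact lt_of_pow_lt_pow_left₀ 2 hε.le (by linarith)
  obtain ⟨p, hp⟩ := cauchySeq_tendsto_of_complete hcau
  have hφt : Tendsto (fun n => φ (q n)) atTop (𝓝 m) := by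
    refine tendsto_of_tendsto_of_tendsto_of_le_of_le tendsto_const_nhds ?_
      (fun n => hmin _ (hqE n)) (fun n => (hqlt n).le)
    simpa using tendsto_const_nhds.add (tendsto_one_div_add_atTop_nhds_zero_nat (𝕜 := ℝ))
  set s : ℝ := m - 1 / 2 * ‖p - z‖ ^ 2 with hs
  have hst : Tendsto (fun n => (q n).2) atTop (𝓝 s) := by
    have := hφt.sub ((((hp.sub_const z).norm).pow 2).const_mul (1 / 2 : ℝ))
    simpa [hφ, hs] using this
  have hmem : (p, s) ∈ E := hE.mem_of_tendsto (hp.prodMk_nhds hst) (Eventually.of_forall hqE)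
  refine ⟨(p, s), hmem, ?_⟩
  rintro ⟨y, t⟩ hy
  rw [← sub_nonneg]
  refine nonneg_of_forall_add_mul_nonneg (a := 1 / 2 * ‖y - p‖ ^ 2) fun τ hτ0 hτ1 => ?_
  have h1 := hmin _ (hc hmem hy (sub_nonneg.2 hτ1.le) hτ0.le (by ring))
  simp only [hφ, Prod.fst_add, Prod.snd_add, Prod.smul_fst, Prod.smul_snd, smul_eq_mul] at h1 ⊢
  have e1 : (1 - τ) • p + τ • y - z = τ • (y - p) - (z - p) := by module
  rw [e1, @norm_sub_sq_real, norm_smul, mul_pow, real_inner_smul_left, Real.norm_eq_abs, sq_abs,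
    real_inner_comm, norm_sub_rev z p] at h1
  refine nonneg_of_mul_nonneg_right ?_ hτ0
  nlinarith

end Prox

/-! ### Subdifferentials of extended-real-valued functions -/

section Subdifferential

variable {H : Type*} [NormedAddCommGroup H] [InnerProductSpace ℝ H]

/-- `B` is strongly monotone with constant `μ`; the constant `0` gives plain monotonicity. -/
def IsStronglyMonotone (μ : ℝ) (B : H → Set H) : Prop :=
  ∀ ⦃x y u v : H⦄, u ∈ B x → v ∈ B y → μ * ‖x - y‖ ^ 2 ≤ inner ℝ (x - y) (u - v)

lemma IsStronglyMonotone.mono {μ ν : ℝ} {B : H → Set H} (h : IsStronglyMonotone ν B)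
    (hμν : μ ≤ ν) : IsStronglyMonotone μ B := fun _ _ _ _ hu hv =>
  (mul_le_mul_of_nonneg_right hμν (sq_nonneg _)).trans (h hu hv)

lemma IsStronglyMonotone.resolvent_subsingleton {B : H → Set H} (h : IsStronglyMonotone 0 B)
    (z : H) : (resolvent B z).Subsingleton := by
  rintro p ⟨v, hv, hpv⟩ p' ⟨v', hv', hpv'⟩
  have h1 := h hv hv'
  have e : v - v' = -(p - p') := by
    rw [eq_sub_of_add_eq' hpv, eq_sub_of_add_eq' hpv']; abel
  rw [e, inner_neg_right, real_inner_self_eq_norm_sq] at h1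
  have h2 : ‖p - p'‖ ^ 2 = 0 := le_antisymm (by linarith) (sq_nonneg _)
  exact sub_eq_zero.1 (norm_eq_zero.1 (pow_eq_zero_iff two_ne_zero |>.1 h2))

/-- Points of the domain of `∂f` lie in the domain of `f`, where the subgradient inequality can be
written with real numbers. -/
lemma exists_coe_eq_of_mem_subdifferential {f : H → EReal} (hf : IsProper f) {x u : H}
    (hu : u ∈ subdifferential f x) : ∃ a : ℝ, f x = a ∧
      ∀ (y : H) (b : ℝ), f y ≤ b → a + inner ℝ u (y - x) ≤ b := by
  have hx : f x ≠ ⊤ := by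
    intro h
    obtain ⟨y, hy⟩ := hf.2
    have := hu y
    rw [h, EReal.top_add_coe, top_le_iff] at this
    exact hy this
  lift f x to ℝ using ⟨hx, hf.1 x⟩ with a ha
  refine ⟨a, rfl, fun y b hb => ?_⟩
  have := (hu y).trans hb
  rw [← ha] at this
  exact_mod_cast this

lemma isStronglyMonotone_zero_subdifferential {f : H → EReal} (hf : IsProper f) :
    IsStronglyMonotone 0 (subdifferential f) := by
  intro x y u v hu hv
  obtain ⟨a, ha, hxu⟩ := exists_coe_eq_of_mem_subdifferential hf hu
  obtain ⟨b, hb, hyv⟩ := exists_coe_eq_of_mem_subdifferential hf hv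
  have h1 := hxu y b hb.le
  have h2 := hyv x a ha.le
  have e1 : inner ℝ u (y - x) = - inner ℝ (x - y) u := by
    rw [← neg_sub x y, inner_neg_right, real_inner_comm]
  rw [e1] at h1
  rw [real_inner_comm] at h2
  rw [inner_sub_right, zero_mul]
  linarith

/-- Strong convexity in terms of real upper bounds of the values. -/
lemma IsStronglyConvex.le_of_le {σ : ℝ} {f : H → EReal} (hf : IsStronglyConvex σ f) {x y : H}
    {a b : ℝ} (hx : f x ≤ a) (hy : f y ≤ b) {t : ℝ} (ht0 : 0 < t) (ht1 : t < 1) :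
    f (t • x + (1 - t) • y)
      ≤ ((t * a + (1 - t) * b - σ / 2 * (t * (1 - t)) * ‖x - y‖ ^ 2 : ℝ) : EReal) := by
  have h1 : (t : EReal) * f x + ((1 - t : ℝ) : EReal) * f y
      ≤ ((t * a + (1 - t) * b : ℝ) : EReal) := by
    rw [EReal.coe_add, EReal.coe_mul, EReal.coe_mul]
    exact add_le_add (mul_le_mul_of_nonneg_left hx (by exact_mod_cast ht0.le))
      (mul_le_mul_of_nonneg_left hy (by exact_mod_cast (sub_pos.2 ht1).le))
  have h2 := (hf x y t ht0 ht1).trans h1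
  rw [EReal.coe_sub]
  rwa [EReal.le_sub_iff_add_le (Or.inl (EReal.coe_ne_bot _)) (Or.inl (EReal.coe_ne_top _))]

lemma IsStronglyConvex.isStronglyMonotone_subdifferential {σ : ℝ} {f : H → EReal}
    (hf : IsStronglyConvex σ f) (hp : IsProper f) : IsStronglyMonotone σ (subdifferential f) := by
  -- the subgradient inequality gains the quadratic term `σ / 2 * ‖y - x‖ ^ 2`
  have key : ∀ {x y u : H} {a b : ℝ}, u ∈ subdifferential f x → f x = a → f y = b →
      0 ≤ b - a - inner ℝ u (y - x) - σ / 2 * ‖y - x‖ ^ 2 := by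
    intro x y u a b hu ha hb
    obtain ⟨a', ha', hxu⟩ := exists_coe_eq_of_mem_subdifferential hp hu
    obtain rfl : a' = a := by exact_mod_cast ha'.symm.trans ha
    refine nonneg_of_forall_add_mul_nonneg (a := σ / 2 * ‖y - x‖ ^ 2) fun t ht0 ht1 => ?_
    have h1 := hxu _ _ (hf.le_of_le hb.le ha.le ht0 ht1)
    have e : t • y + (1 - t) • x - x = t • (y - x) := by module
    rw [e, real_inner_smul_right] at h1
    refine nonneg_of_mul_nonneg_right ?_ ht0
    nlinarith
  intro x y u v hu hv
  obtain ⟨a, ha, -⟩ := exists_coe_eq_of_mem_subdifferential hp hu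
  obtain ⟨b, hb, -⟩ := exists_coe_eq_of_mem_subdifferential hp hv
  have h1 := key hu ha hb
  have h2 := key hv hb ha
  have e1 : inner ℝ u (y - x) = - inner ℝ (x - y) u := by
    rw [← neg_sub x y, inner_neg_right, real_inner_comm]
  rw [e1, norm_sub_rev y x] at h1
  rw [real_inner_comm] at h2
  rw [inner_sub_right]
  linarith

/-- The resolvent of `∂f` is everywhere defined (Minty's theorem for subdifferentials). -/
lemma IsStronglyConvex.resolvent_subdifferential_nonempty [CompleteSpace H] {σ : ℝ} (hσ : 0 ≤ σ)
    {f : H → EReal} (hf : IsStronglyConvex σ f) (hp : IsProper f) (hl : LowerSemicontinuous f)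
    (z : H) : (resolvent (subdifferential f) z).Nonempty := by
  have hE : IsClosed {q : H × ℝ | f q.1 ≤ (q.2 : EReal)} :=
    hl.isClosed_epigraph.preimage
      (continuous_fst.prodMk (continuous_coe_real_ereal.comp continuous_snd))
  have hc : Convex ℝ {q : H × ℝ | f q.1 ≤ (q.2 : EReal)} := by
    refine convex_iff_forall_pos.2 ?_
    rintro ⟨x, a⟩ hx ⟨y, b⟩ hy s t hs ht hst
    obtain rfl : t = 1 - s := by linarith
    have h1 := hf.le_of_le hx hy hs (by linarith)
    refine h1.trans (EReal.coe_le_coe_iff.2 ?_)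
    have : 0 ≤ σ / 2 * (s * (1 - s)) * ‖x - y‖ ^ 2 := by positivity
    simp only [Prod.smul_mk, Prod.mk_add_mk, smul_eq_mul]
    linarith
  obtain ⟨x₀, hx₀⟩ := hp.2
  obtain ⟨a, ha⟩ : ∃ a : ℝ, f x₀ = a := ⟨_, (EReal.coe_toReal hx₀ (hp.1 x₀)).symm⟩
  obtain ⟨⟨p, s⟩, hps, hmin⟩ := exists_prox_of_isClosed_convex hE hc (x₀ := x₀) (s₀ := a) ha.le
    (by
      simp only [Set.mem_ofPred_eq, ha, EReal.coe_le_coe_iff]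
      linarith) z
  refine ⟨p, z - p, fun y => ?_, by abel⟩
  by_cases hy : f y = ⊤
  · rw [hy]; exact le_top
  obtain ⟨b, hb⟩ : ∃ b : ℝ, f y = b := ⟨_, (EReal.coe_toReal hy (hp.1 y)).symm⟩
  refine (add_le_add_left hps _).trans ?_
  rw [hb]
  exact_mod_cast hmin (y, b) hb.le

end Subdifferential

/-! ### Smooth convex functions and their conjugates -/

section Smooth

variable {H : Type*} [NormedAddCommGroup H] [InnerProductSpace ℝ H] [CompleteSpace H]

lemma hasDerivAt_comp_add_smul {g : H → ℝ} (hd : Differentiable ℝ g) (x v : H) (t : ℝ) :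
    HasDerivAt (fun t : ℝ => g (x + t • v)) (inner ℝ (gradient g (x + t • v)) v) t := by
  have h1 : HasDerivAt (fun t : ℝ => x + t • v) v t := by
    simpa using ((hasDerivAt_id t).smul_const v).const_add x
  exact (hd (x + t • v)).hasGradientAt.hasFDerivAt.comp_hasDerivAt t h1

lemma _root_.ConvexOn.add_inner_gradient_le {g : H → ℝ} (hg : ConvexOn ℝ Set.univ g)
    (hd : Differentiable ℝ g) (x y : H) : g x + inner ℝ (gradient g x) (y - x) ≤ g y := by
  have hconv : ConvexOn ℝ Set.univ (fun t : ℝ => g (x + t • (y - x))) := by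
    refine ⟨convex_univ, fun s _ t _ a b ha hb hab => ?_⟩
    have := hg.2 (Set.mem_univ (x + s • (y - x))) (Set.mem_univ (x + t • (y - x))) ha hb hab
    convert this using 2
    obtain rfl : a = 1 - b := by linarith
    simp only [smul_eq_mul]
    module
  have h0 := hasDerivAt_comp_add_smul hd x (y - x) 0
  have := hconv.le_slope_of_hasDerivAt (Set.mem_univ 0) (Set.mem_univ 1) zero_lt_one h0
  simp only [slope_def_field, zero_smul, add_zero, one_smul, add_sub_cancel, sub_zero, div_one]
    at this
  linarith

/-- The descent lemma. -/
lemma le_add_inner_gradient_add_sq {g : H → ℝ} (hd : Differentiable ℝ g) {β : ℝ}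
    (hlip : ∀ y y' : H, ‖gradient g y - gradient g y'‖ ≤ β * ‖y - y'‖) (x v : H) :
    g (x + v) ≤ g x + inner ℝ (gradient g x) v + β / 2 * ‖v‖ ^ 2 := by
  set ψ : ℝ → ℝ := fun t => g (x + t • v) - t * inner ℝ (gradient g x) v - β / 2 * ‖v‖ ^ 2 * t ^ 2
    with hψ
  have hder : ∀ t, HasDerivAt ψ (inner ℝ (gradient g (x + t • v)) v - inner ℝ (gradient g x) v
      - β / 2 * ‖v‖ ^ 2 * (2 * t)) t := by
    intro t
    have h1 := (hasDerivAt_id t).mul_const (inner ℝ (gradient g x) v)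
    have h2 := (hasDerivAt_pow 2 t).const_mul (β / 2 * ‖v‖ ^ 2)
    rw [one_mul] at h1
    rw [Nat.cast_ofNat, Nat.add_one_sub_one, pow_one] at h2
    exact ((hasDerivAt_comp_add_smul hd x v t).sub h1).sub h2
  have hanti : AntitoneOn ψ (Set.Icc 0 1) := by
    refine antitoneOn_of_deriv_nonpos (convex_Icc 0 1)
      (fun t _ => (hder t).continuousAt.continuousWithinAt)
      (fun t _ => (hder t).differentiableAt.differentiableWithinAt) fun t ht => ?_
    rw [interior_Icc] at ht
    rw [(hder t).deriv, ← inner_sub_left]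
    have h1 := real_inner_le_norm (gradient g (x + t • v) - gradient g x) v
    have h2 := hlip (x + t • v) x
    rw [add_sub_cancel_left, norm_smul, Real.norm_of_nonneg ht.1.le] at h2
    have h3 := mul_le_mul_of_nonneg_right h2 (norm_nonneg v)
    nlinarith
  have := hanti (Set.left_mem_Icc.2 zero_le_one) (Set.right_mem_Icc.2 zero_le_one) zero_le_one
  simp only [hψ, zero_smul, add_zero, one_smul, zero_mul, one_mul, sub_zero, one_pow, mul_one,
    ne_eq, OfNat.ofNat_ne_zero, not_false_eq_true, zero_pow, mul_zero] at this
  linarith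

/-- The Baillon–Haddad theorem: the gradient of a convex function is cocoercive as soon as it is
Lipschitz continuous. -/
lemma _root_.ConvexOn.gradient_cocoercive {g : H → ℝ} (hg : ConvexOn ℝ Set.univ g)
    (hd : Differentiable ℝ g) {β : ℝ} (hβ : 0 < β)
    (hlip : ∀ y y' : H, ‖gradient g y - gradient g y'‖ ≤ β * ‖y - y'‖) (x y : H) :
    1 / β * ‖gradient g x - gradient g y‖ ^ 2
      ≤ inner ℝ (gradient g x - gradient g y) (x - y) := by
  -- compare the values at `x` and at the gradient step from `y` for the convex function
  -- `g - ⟪∇ g x, ·⟫`, which is minimal at `x`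
  have key : ∀ x y : H, g x + inner ℝ (gradient g x) (y - x)
      + 1 / (2 * β) * ‖gradient g x - gradient g y‖ ^ 2 ≤ g y := by
    intro x y
    set d := gradient g x - gradient g y with hd'
    have h1 := hg.add_inner_gradient_le hd x (y + (1 / β) • d)
    have h2 := le_add_inner_gradient_add_sq hd hlip y ((1 / β) • d)
    rw [add_sub_right_comm, inner_add_right, real_inner_smul_right] at h1
    rw [real_inner_smul_right, norm_smul, mul_pow, Real.norm_eq_abs, sq_abs] at h2
    have h3 : inner ℝ (gradient g x) d - inner ℝ (gradient g y) d = ‖d‖ ^ 2 := by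
      rw [← inner_sub_left, ← hd', real_inner_self_eq_norm_sq]
    have e1 : β / 2 * ((1 / β) ^ 2 * ‖d‖ ^ 2) = 1 / (2 * β) * ‖d‖ ^ 2 := by field_simp
    have e2 : 1 / β * ‖d‖ ^ 2 = 2 * (1 / (2 * β) * ‖d‖ ^ 2) := by field_simp
    have e3 : 1 / β * inner ℝ (gradient g x) d - 1 / β * inner ℝ (gradient g y) d
        = 2 * (1 / (2 * β) * ‖d‖ ^ 2) := by rw [← mul_sub, h3, e2]
    linarith
  have h1 := key x y
  have h2 := key y x
  rw [norm_sub_rev (gradient g y)] at h2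
  have e2 : 1 / β * ‖gradient g x - gradient g y‖ ^ 2
      = 2 * (1 / (2 * β) * ‖gradient g x - gradient g y‖ ^ 2) := by field_simp
  rw [← neg_sub x y, inner_neg_right] at h1
  rw [inner_sub_left]
  linarith

omit [CompleteSpace H] in
lemma coe_inner_sub_le_conjugate (g : H → ℝ) (v y : H) :
    ((inner ℝ v y - g y : ℝ) : EReal) ≤ conjugate (fun y => (g y : EReal)) v := by
  rw [EReal.coe_sub]
  exact le_iSup (fun x : H => ((inner ℝ v x : ℝ) : EReal) - (g x : EReal)) y

lemma _root_.ConvexOn.conjugate_gradient {g : H → ℝ} (hg : ConvexOn ℝ Set.univ g)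
    (hd : Differentiable ℝ g) (y : H) :
    conjugate (fun y => (g y : EReal)) (gradient g y)
      = ((inner ℝ (gradient g y) y - g y : ℝ) : EReal) := by
  refine le_antisymm (iSup_le fun x => ?_) (coe_inner_sub_le_conjugate g _ y)
  have := hg.add_inner_gradient_le hd y x
  rw [inner_sub_right] at this
  rw [← EReal.coe_sub, EReal.coe_le_coe_iff]
  linarith

lemma _root_.ConvexOn.isProper_conjugate {g : H → ℝ} (hg : ConvexOn ℝ Set.univ g)
    (hd : Differentiable ℝ g) : IsProper (conjugate fun y => (g y : EReal)) := by
  refine ⟨fun v => ?_, gradient g 0, ?_⟩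
  · exact ((EReal.bot_lt_coe _).trans_le (coe_inner_sub_le_conjugate g v 0)).ne'
  · rw [hg.conjugate_gradient hd]
    exact EReal.coe_ne_top _

lemma _root_.ConvexOn.mem_subdifferential_conjugate_gradient {g : H → ℝ}
    (hg : ConvexOn ℝ Set.univ g) (hd : Differentiable ℝ g) (y : H) :
    y ∈ subdifferential (conjugate fun y => (g y : EReal)) (gradient g y) := by
  intro v
  refine le_trans (le_of_eq ?_) (coe_inner_sub_le_conjugate g v y)
  rw [hg.conjugate_gradient hd, ← EReal.coe_add, EReal.coe_eq_coe_iff, inner_sub_right,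
    real_inner_comm v y, real_inner_comm (gradient g y) y]
  ring

/-- `Id + ∇g` is onto. -/
lemma _root_.ConvexOn.exists_gradient_add_eq {g : H → ℝ} (hg : ConvexOn ℝ Set.univ g)
    (hd : Differentiable ℝ g) (z : H) : ∃ y, gradient g y + y = z := by
  obtain ⟨⟨q, s⟩, hqs, hmin⟩ := exists_prox_of_isClosed_convex
    (E := {p : H × ℝ | g p.1 ≤ p.2})
    (isClosed_le (hd.continuous.comp continuous_fst) continuous_snd)
    (by simpa using hg.convex_epigraph) (x₀ := 0) (s₀ := g 0) (le_refl (g 0))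
    (by simp) z
  refine ⟨q, ?_⟩
  -- compare along the line through `q` in the direction of the defect
  set d := z - q - gradient g q with hd'
  have hder := (hasDerivAt_comp_add_smul hd q d 0).sub
    ((hasDerivAt_id (0 : ℝ)).mul_const (inner ℝ (z - q) d))
  have hloc : IsLocalMin (fun t : ℝ => g (q + t • d) - t * inner ℝ (z - q) d) 0 := by
    refine Eventually.of_forall fun t => ?_
    have h1 := hmin (q + t • d, g (q + t • d)) (le_refl (g (q + t • d)))
    simp only [add_sub_cancel_left, real_inner_smul_right, Set.mem_ofPred_eq] at h1 hqs
    simp only [zero_smul, add_zero, zero_mul, sub_zero]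
    linarith
  have h0 := hloc.hasDerivAt_eq_zero hder
  simp only [zero_smul, add_zero, one_mul] at h0
  rw [← inner_sub_left, ← neg_sub (z - q), ← hd', inner_neg_left, real_inner_self_eq_norm_sq] at h0
  have h2 : d = 0 := by simpa using h0
  rw [hd', sub_eq_zero] at h2
  rw [← h2]; abel

lemma _root_.ConvexOn.resolvent_subdifferential_conjugate_nonempty {g : H → ℝ}
    (hg : ConvexOn ℝ Set.univ g) (hd : Differentiable ℝ g) (z : H) :
    (resolvent (subdifferential (conjugate fun y => (g y : EReal))) z).Nonempty := by
  obtain ⟨y, hy⟩ := hg.exists_gradient_add_eq hd z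
  exact ⟨gradient g y, y, hg.mem_subdifferential_conjugate_gradient hd y, hy⟩

/-- Subgradients of the conjugate invert the gradient. Since `Id + ∇g` is onto, the resolvent of
`∂g*` at `v + y` contains some `∇g y'` with `∇g y' + y' = v + y`; as it is single-valued,
`v = ∇g y'` and `y = y'`. -/
lemma _root_.ConvexOn.gradient_eq_of_mem_subdifferential_conjugate {g : H → ℝ}
    (hg : ConvexOn ℝ Set.univ g) (hd : Differentiable ℝ g) {v y : H}
    (h : y ∈ subdifferential (conjugate fun y => (g y : EReal)) v) : gradient g y = v := by
  obtain ⟨y', hy'⟩ := hg.exists_gradient_add_eq hd (v + y)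
  have hv : gradient g y' = v :=
    (isStronglyMonotone_zero_subdifferential (hg.isProper_conjugate hd)).resolvent_subsingleton
      (v + y) ⟨y', hg.mem_subdifferential_conjugate_gradient hd y', hy'⟩ ⟨y, h, rfl⟩
  rw [hv, add_right_inj] at hy'
  rw [← hy', hv]

/-- If `∇g` is `β`-Lipschitz continuous, then `∂g*` is strongly monotone with constant `1 / β`. -/
lemma _root_.ConvexOn.isStronglyMonotone_subdifferential_conjugate {g : H → ℝ}
    (hg : ConvexOn ℝ Set.univ g) (hd : Differentiable ℝ g) {β : ℝ} (hβ : 0 < β)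
    (hlip : ∀ y y' : H, ‖gradient g y - gradient g y'‖ ≤ β * ‖y - y'‖) :
    IsStronglyMonotone (1 / β) (subdifferential (conjugate fun y => (g y : EReal))) := by
  intro x y u v hu hv
  rw [← hg.gradient_eq_of_mem_subdifferential_conjugate hd hu,
    ← hg.gradient_eq_of_mem_subdifferential_conjugate hd hv]
  exact hg.gradient_cocoercive hd hβ hlip u v

end Smooth

/-! ### Douglas–Rachford iteration for a skew and a strongly monotone operator -/

section DouglasRachford

variable {H : Type*} [NormedAddCommGroup H] [InnerProductSpace ℝ H]

lemma rate_pos (ℓ : ℝ) {μ : ℝ} (hμ : 0 < μ) : 0 < rate ℓ μ := by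
  unfold rate; positivity

lemma rate_lt_one (ℓ : ℝ) {μ : ℝ} (hμ : 0 < μ) : rate ℓ μ < 1 := by
  unfold rate
  have hc : 0 < (1 + ℓ ^ 2)⁻¹ := by positivity
  -- the radicand is smaller than `(2 * μ + 1) ^ 2`, its value for `ℓ = ∞`
  have h1 : Real.sqrt (2 * μ ^ 2 + 2 * μ + 1 + 2 * (1 - 2 * (1 + ℓ ^ 2)⁻¹) * μ * (1 + μ))
      < 2 * μ + 1 := by
    rw [Real.sqrt_lt' (by positivity)]
    have : 0 < (1 + ℓ ^ 2)⁻¹ * (μ * (1 + μ)) := by positivity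
    nlinarith
  rw [one_div, inv_mul_lt_iff₀ (by positivity)]
  linarith

/-- The contraction estimate. Here `u` is the reflection of `x` in the skew operator, `p` is the
resolvent of the strongly monotone operator at `u`; the angle between `x` and `u` is bounded away
from `π`, and `2 p` lies in the ball with center `u / (1 + μ)` and radius `‖u‖ / (1 + μ)`. -/
lemma norm_half_add_reflection_le {x u p : H} {ℓ μ : ℝ} (hμ : 0 < μ) (hux : ‖u‖ = ‖x‖)
    (hangle : -(1 - 2 * (1 + ℓ ^ 2)⁻¹) * ‖x‖ ^ 2 ≤ inner ℝ x u)
    (hp : μ * ‖p‖ ^ 2 ≤ inner ℝ p (u - p)) :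
    ‖(1 / 2 : ℝ) • (x + ((2 : ℝ) • p - u))‖ ≤ rate ℓ μ * ‖x‖ := by
  set c : ℝ := 1 - 2 * (1 + ℓ ^ 2)⁻¹ with hc
  set S : ℝ := 2 * μ ^ 2 + 2 * μ + 1 + 2 * c * μ * (1 + μ) with hS
  have hk : 0 < 1 + μ := by linarith
  have h1 : ‖(2 * (1 + μ)) • p - u‖ ≤ ‖x‖ := by
    rw [← hux]
    refine le_of_sq_le_sq ?_ (norm_nonneg _)
    rw [inner_sub_right, real_inner_self_eq_norm_sq] at hp
    rw [norm_sub_sq_real, norm_smul, mul_pow, real_inner_smul_left, Real.norm_eq_abs, sq_abs]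
    nlinarith
  have h2 : ‖(1 + μ) • x - μ • u‖ ≤ Real.sqrt S * ‖x‖ := by
    rw [← Real.sqrt_sq (norm_nonneg x), ← Real.sqrt_mul' _ (sq_nonneg _)]
    refine Real.le_sqrt_of_sq_le ?_
    rw [norm_sub_sq_real, norm_smul, norm_smul, mul_pow, mul_pow, real_inner_smul_left,
      real_inner_smul_right, Real.norm_eq_abs, Real.norm_eq_abs, sq_abs, sq_abs, hux]
    have := mul_le_mul_of_nonneg_left hangle (by positivity : 0 ≤ 2 * ((1 + μ) * μ))
    rw [hS]
    linarith
  have e : (1 / 2 : ℝ) • (x + ((2 : ℝ) • p - u))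
      = (1 / (2 * (1 + μ))) • (((1 + μ) • x - μ • u) + ((2 * (1 + μ)) • p - u)) := by
    match_scalars <;> field_simp; ring
  rw [e, norm_smul, Real.norm_of_nonneg (by positivity), rate, ← hc, ← hS, mul_assoc]
  refine mul_le_mul_of_nonneg_left ?_ (by positivity)
  calc _ ≤ _ := norm_add_le _ _
    _ ≤ Real.sqrt S * ‖x‖ + ‖x‖ := add_le_add h2 h1
    _ = _ := by ring

omit [InnerProductSpace ℝ H] in
lemma norm_iterate_sub_le {T : H → H} {xbar : H} {r : ℝ} (hr : 0 ≤ r) (hfix : T xbar = xbar)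
    (hT : ∀ x y, ‖T x - T y‖ ≤ r * ‖x - y‖) (x₀ : H) (n : ℕ) :
    ‖T^[n] x₀ - xbar‖ ≤ ‖x₀ - xbar‖ * r ^ n := by
  induction n with
  | zero => simp
  | succ n ih =>
    rw [Function.iterate_succ_apply']
    calc ‖T (T^[n] x₀) - xbar‖ = ‖T (T^[n] x₀) - T xbar‖ := by rw [hfix]
      _ ≤ r * ‖T^[n] x₀ - xbar‖ := hT _ _
      _ ≤ r * (‖x₀ - xbar‖ * r ^ n) := by gcongr
      _ = _ := by ring

omit [InnerProductSpace ℝ H] in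
lemma ConvergesLinearly.of_norm_sub_le {u : ℕ → H} {l : H} {r C : ℝ} (hr : 0 ≤ r) (hr1 : r < 1)
    (h : ∀ n, ‖u n - l‖ ≤ C * r ^ n) : ConvergesLinearly u l r C := by
  refine ⟨tendsto_iff_norm_sub_tendsto_zero.2 ?_, h⟩
  refine squeeze_zero (fun _ => norm_nonneg _) h ?_
  simpa using (tendsto_pow_atTop_nhds_zero_of_lt_one hr hr1).const_mul C

lemma fixedPoints_drOperator (R S : H → H) :
    Function.fixedPoints (drOperator R S) = Function.fixedPoints (R ∘ S) := by
  ext x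
  simp only [Function.mem_fixedPoints, Function.IsFixedPt, drOperator, Function.comp]
  constructor
  · intro h
    have h2 : (2 : ℝ) • ((1 / 2 : ℝ) • (x + R (S x))) = (2 : ℝ) • x := by rw [h]
    rw [smul_smul, two_smul] at h2
    norm_num at h2
    exact h2
  · intro h
    rw [h]; module

omit [InnerProductSpace ℝ H] in
lemma exists_fixedPoints_eq_singleton [CompleteSpace H] {T : H → H} {r : ℝ} (hr : 0 ≤ r)
    (hr1 : r < 1) (hT : ∀ x y, ‖T x - T y‖ ≤ r * ‖x - y‖) :
    ∃ xbar, Function.fixedPoints T = {xbar} := by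
  have hc : ContractingWith ⟨r, hr⟩ T :=
    ⟨by exact_mod_cast hr1, LipschitzWith.of_dist_le_mul fun x y => by
      rw [dist_eq_norm, dist_eq_norm]; exact hT x y⟩
  refine ⟨hc.fixedPoint T, Set.eq_singleton_iff_unique_mem.2
    ⟨hc.fixedPoint_isFixedPt, fun y hy => hc.fixedPoint_unique hy⟩⟩

/-- Linear convergence of both Douglas–Rachford iterations for a bounded skew operator `A` and a
strongly monotone operator `B` with everywhere defined resolvent. -/
theorem douglasRachford_linear_convergence [CompleteSpace H] {A : H →L[ℝ] H} {ℓ μ : ℝ}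
    (hskew : ∀ z, inner ℝ (A z) z = 0) (hbound : ∀ z, ‖A z‖ ^ 2 ≤ ℓ ^ 2 * ‖z‖ ^ 2)
    {B : H → Set H} (hμ : 0 < μ) (hB : IsStronglyMonotone μ B)
    (hres : ∀ z, (resolvent B z).Nonempty) :
    ∃ JA JB : H → H, (∀ z, resolvent (fun z => {A z}) z = {JA z}) ∧
      (∀ z, resolvent B z = {JB z}) ∧
      ∃ xbar xhat : H,
        Function.fixedPoints (drOperator (reflected JB) (reflected JA)) = {xbar} ∧
        Function.fixedPoints (drOperator (reflected JA) (reflected JB)) = {xhat} ∧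
        zerSum (fun z => {A z}) B = {JA xbar} ∧ JB xhat = JA xbar ∧
        ∀ x₀ : H,
          ConvergesLinearly (fun n => (drOperator (reflected JB) (reflected JA))^[n] x₀) xbar
            (rate ℓ μ) ‖x₀ - xbar‖ ∧
          ConvergesLinearly (fun n => JA ((drOperator (reflected JB) (reflected JA))^[n] x₀))
            (JA xbar) (rate ℓ μ) ‖x₀ - xbar‖ ∧
          ConvergesLinearly (fun n => (drOperator (reflected JA) (reflected JB))^[n] x₀) xhat
            (rate ℓ μ) ‖x₀ - xhat‖ ∧
          ConvergesLinearly (fun n => JB ((drOperator (reflected JA) (reflected JB))^[n] x₀))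
            (JB xhat) (rate ℓ μ) ‖x₀ - xhat‖ := by
  have hr := (rate_pos ℓ hμ).le
  have hr1 := rate_lt_one ℓ hμ
  -- `Id + A` is coercive, hence invertible
  have hunit : IsUnit (1 + A) := by
    refine ContinuousLinearMap.isUnit_of_forall_le_norm_inner_map _ (c := 1) one_pos fun z => ?_
    simp only [add_apply, one_apply_eq_self, inner_add_left, hskew,
      add_zero, real_inner_self_eq_norm_sq, NNReal.coe_one, mul_one]
    exact le_abs_self _
  obtain ⟨M, hM⟩ := hunit
  set J : H →L[ℝ] H := ↑M⁻¹ with hJ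
  have hAJ : ∀ z, J z + A (J z) = z := by
    intro z
    have := congrArg (fun F : H →L[ℝ] H => F z) M.mul_inv
    simpa [hM, hJ] using this
  have hJA : ∀ z, J (z + A z) = z := by
    intro z
    have := congrArg (fun F : H →L[ℝ] H => F z) M.inv_mul
    simpa [hM, hJ, add_comm] using this
  choose JB hJBmem using hres
  have hBsub := (hB.mono hμ.le).resolvent_subsingleton
  have hJB : ∀ z, resolvent B z = {JB z} := fun z => (hBsub z).eq_singleton_of_mem (hJBmem z)
  have hJBeq : ∀ {p z : H}, p ∈ resolvent B z → JB z = p := fun hp => hBsub _ (hJBmem _) hp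
  -- Pythagoras for the skew operator
  have hpyth : ∀ z, ‖z‖ ^ 2 = ‖J z‖ ^ 2 + ‖A (J z)‖ ^ 2 := by
    intro z
    conv_lhs => rw [← hAJ z]
    rw [norm_add_sq_real, real_inner_comm, hskew]; ring
  -- the reflection in `A` is the Cayley transform, a linear isometry
  have hRA : ∀ z, reflected J z = J z - A (J z) := by
    intro z
    rw [reflected, two_smul, sub_eq_sub_iff_add_eq_add, add_assoc, hAJ]
  have hRnorm : ∀ z, ‖reflected J z‖ = ‖z‖ := by
    intro z
    rw [← sq_eq_sq₀ (norm_nonneg _) (norm_nonneg _), hRA, norm_sub_sq_real, real_inner_comm, hskew,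
      hpyth z]
    ring
  let R : H →ₗᵢ[ℝ] H := ⟨((2 : ℝ) • J - 1 : H →L[ℝ] H).toLinearMap, hRnorm⟩
  have hR : reflected J = R := rfl
  have hangle : ∀ z, -(1 - 2 * (1 + ℓ ^ 2)⁻¹) * ‖z‖ ^ 2 ≤ inner ℝ z (R z) := by
    intro z
    have h1 : inner ℝ z (R z) = ‖J z‖ ^ 2 - ‖A (J z)‖ ^ 2 := by
      rw [← hR, hRA]
      conv_lhs => enter [2]; rw [← hAJ z]
      rw [inner_add_left, inner_sub_right, inner_sub_right, hskew,
        real_inner_comm (A (J z)), hskew, real_inner_self_eq_norm_sq, real_inner_self_eq_norm_sq]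
      ring
    have h2 : (1 + ℓ ^ 2)⁻¹ * ‖z‖ ^ 2 ≤ ‖J z‖ ^ 2 := by
      rw [inv_mul_le_iff₀ (by positivity)]
      linarith [hpyth z, hbound (J z)]
    linarith [hpyth z]
  have hJBmono : ∀ a b, μ * ‖JB a - JB b‖ ^ 2
      ≤ inner ℝ (JB a - JB b) (a - b - (JB a - JB b)) := by
    intro a b
    obtain ⟨u, hu, hau⟩ := hJBmem a
    obtain ⟨v, hv, hbv⟩ := hJBmem b
    have e : a - b - (JB a - JB b) = u - v := by
      rw [eq_sub_of_add_eq' hau, eq_sub_of_add_eq' hbv]; abel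
    rw [e]
    exact hB hu hv
  have hJnonexp : ∀ x y, ‖J x - J y‖ ≤ ‖x - y‖ := by
    intro x y
    rw [← map_sub]
    refine le_of_sq_le_sq ?_ (norm_nonneg _)
    linarith [hpyth (x - y), sq_nonneg ‖A (J (x - y))‖]
  have hJBnonexp : ∀ x y, ‖JB x - JB y‖ ≤ ‖x - y‖ := by
    intro x y
    have h1 := hJBmono x y
    rw [inner_sub_right, real_inner_self_eq_norm_sq] at h1
    have h2 := real_inner_le_norm (JB x - JB y) (x - y)
    have h3 : 0 ≤ μ * ‖JB x - JB y‖ ^ 2 := by positivity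
    by_contra! h4
    nlinarith [norm_nonneg (x - y)]
  have hT : ∀ x y, ‖drOperator (reflected JB) (reflected J) x
      - drOperator (reflected JB) (reflected J) y‖ ≤ rate ℓ μ * ‖x - y‖ := by
    intro x y
    have h := norm_half_add_reflection_le hμ (R.norm_map (x - y)) (hangle (x - y))
      (p := JB (R x) - JB (R y)) (by rw [map_sub]; exact hJBmono _ _)
    convert h using 2
    rw [hR, map_sub]
    simp only [drOperator, reflected]
    module
  have hT' : ∀ x y, ‖drOperator (reflected J) (reflected JB) x
      - drOperator (reflected J) (reflected JB) y‖ ≤ rate ℓ μ * ‖x - y‖ := by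
    intro x y
    -- transport the monotonicity of `JB` by the isometry `R`
    have h := norm_half_add_reflection_le hμ (R.norm_map (x - y)) (hangle (x - y))
      (p := R (JB x - JB y)) (by
        rw [← map_sub, R.inner_map_map, R.norm_map]; exact hJBmono _ _)
    convert h using 2
    simp only [drOperator]
    rw [hR]
    simp only [reflected, map_sub, map_smul]
    module
  obtain ⟨xbar, hxbar⟩ := exists_fixedPoints_eq_singleton hr hr1 hT
  obtain ⟨xhat, hxhat⟩ := exists_fixedPoints_eq_singleton hr hr1 hT'
  have hfix : drOperator (reflected JB) (reflected J) xbar = xbar :=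
    (Set.eq_singleton_iff_unique_mem.1 hxbar).1
  have hfix' : drOperator (reflected J) (reflected JB) xhat = xhat :=
    (Set.eq_singleton_iff_unique_mem.1 hxhat).1
  have hRfix : reflected JB (R xbar) = xbar := by
    have : xbar ∈ Function.fixedPoints (reflected JB ∘ reflected J) := by
      rw [← fixedPoints_drOperator]; exact hfix
    exact this
  have hRR : R xbar = xhat := by
    have : R xbar ∈ Function.fixedPoints (drOperator (reflected J) (reflected JB)) := by
      rw [fixedPoints_drOperator]
      exact congrArg R hRfix
    rwa [hxhat] at this
  -- `x` is a fixed point iff `J x` and the resolvent of `B` at `R x` agree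
  have hJiff : ∀ x, reflected JB (R x) = x ↔ JB (R x) = J x := by
    intro x
    have e : x = (2 : ℝ) • J x - R x := by
      rw [← hR, reflected]; abel
    conv_lhs => rhs; rw [e]
    rw [reflected, sub_left_inj]
    exact smul_right_injective H (two_ne_zero' ℝ) |>.eq_iff
  have hJBhat : JB xhat = J xbar := by
    rw [← hRR]; exact (hJiff xbar).1 hRfix
  have hzer : zerSum (fun z => {A z}) B = {J xbar} := by
    refine Set.eq_singleton_iff_unique_mem.2 ⟨?_, ?_⟩
    · obtain ⟨v, hv, hxv⟩ := hJBmem xhat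
      rw [hJBhat] at hv hxv
      refine ⟨_, rfl, v, hv, ?_⟩
      rw [← hRR, ← hR, hRA, sub_eq_add_neg, add_right_inj] at hxv
      rw [hxv, add_neg_cancel]
    · rintro z ⟨_, rfl, b, hb, hab⟩
      have hRz : R (z + A z) = z - A z := by
        rw [← hR, hRA, hJA]
      have h1 : JB (R (z + A z)) = J (z + A z) := by
        rw [hJA, hRz]
        refine hJBeq ⟨b, hb, ?_⟩
        rw [← neg_eq_of_add_eq_zero_right hab, sub_eq_add_neg]
      have h2 : z + A z ∈ Function.fixedPoints (drOperator (reflected JB) (reflected J)) := by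
        rw [fixedPoints_drOperator]
        exact (hJiff _).2 h1
      rw [hxbar] at h2
      rw [← Set.mem_singleton_iff.1 h2, hJA]
  refine ⟨J, JB, fun z => ?_, hJB, xbar, xhat, hxbar, hxhat, hzer, hJBhat, fun x₀ => ?_⟩
  · refine Set.eq_singleton_iff_unique_mem.2 ⟨⟨_, rfl, hAJ z⟩, ?_⟩
    rintro p ⟨_, rfl, hp⟩
    rw [← hp, hJA]
  · have h1 := norm_iterate_sub_le hr hfix hT x₀
    have h2 := norm_iterate_sub_le hr hfix' hT' x₀
    exact ⟨.of_norm_sub_le hr hr1 h1,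
      .of_norm_sub_le hr hr1 fun n => (hJnonexp _ _).trans (h1 n),
      .of_norm_sub_le hr hr1 h2,
      .of_norm_sub_le hr hr1 fun n => (hJBnonexp _ _).trans (h2 n)⟩

end DouglasRachford
/-! ### The primal-dual operators on the product space -/

section PrimalDual

variable {X Y : Type*} [NormedAddCommGroup X] [InnerProductSpace ℝ X] [CompleteSpace X]
  [NormedAddCommGroup Y] [InnerProductSpace ℝ Y] [CompleteSpace Y]

/-- The skew map `(x, y) ↦ (L* y, -L x)` as a bounded linear operator. -/
noncomputable def skewCLM (L : X →L[ℝ] Y) : WithLp 2 (X × Y) →L[ℝ] WithLp 2 (X × Y) :=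
  (WithLp.prodContinuousLinearEquiv 2 ℝ X Y).symm.toContinuousLinearMap ∘L
    (((ContinuousLinearMap.adjoint L) ∘L ContinuousLinearMap.snd ℝ X Y).prod
      (-(L ∘L ContinuousLinearMap.fst ℝ X Y))) ∘L
    (WithLp.prodContinuousLinearEquiv 2 ℝ X Y).toContinuousLinearMap

lemma skewCLM_apply (L : X →L[ℝ] Y) (z : WithLp 2 (X × Y)) :
    skewCLM L z = WithLp.toLp 2 (ContinuousLinearMap.adjoint L z.snd, -(L z.fst)) := rfl

lemma opA_eq_skewCLM (L : X →L[ℝ] Y) : opA L = fun z => {skewCLM L z} := rfl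

lemma inner_skewCLM_self (L : X →L[ℝ] Y) (z : WithLp 2 (X × Y)) :
    inner ℝ (skewCLM L z) z = 0 := by
  rw [skewCLM_apply, WithLp.prod_inner_apply]
  change inner ℝ (ContinuousLinearMap.adjoint L z.snd) z.fst + inner ℝ (-(L z.fst)) z.snd = 0
  rw [ContinuousLinearMap.adjoint_inner_left, inner_neg_left, real_inner_comm, add_neg_cancel]

lemma norm_skewCLM_sq_le (L : X →L[ℝ] Y) (z : WithLp 2 (X × Y)) :
    ‖skewCLM L z‖ ^ 2 ≤ ‖L‖ ^ 2 * ‖z‖ ^ 2 := by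
  rw [skewCLM_apply, WithLp.prod_norm_sq_eq_of_L2, WithLp.prod_norm_sq_eq_of_L2]
  change ‖ContinuousLinearMap.adjoint L z.snd‖ ^ 2 + ‖-(L z.fst)‖ ^ 2
    ≤ ‖L‖ ^ 2 * (‖z.fst‖ ^ 2 + ‖z.snd‖ ^ 2)
  have h1 := (ContinuousLinearMap.adjoint L).le_opNorm z.snd
  rw [LinearIsometryEquiv.norm_map] at h1
  have h2 := pow_le_pow_left₀ (norm_nonneg _) h1 2
  have h3 := pow_le_pow_left₀ (norm_nonneg _) (L.le_opNorm z.fst) 2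
  rw [norm_neg]
  linarith

omit [CompleteSpace X] [CompleteSpace Y] in
lemma isStronglyMonotone_opB {f : X → EReal} {g : Y → ℝ} {μ : ℝ}
    (hf : IsStronglyMonotone μ (subdifferential f))
    (hg : IsStronglyMonotone μ (subdifferential (conjugate fun y => (g y : EReal)))) :
    IsStronglyMonotone μ (opB f g) := by
  intro x y u v hu hv
  rw [WithLp.prod_norm_sq_eq_of_L2, WithLp.prod_inner_apply, mul_add]
  exact add_le_add (hf hu.1 hv.1) (hg hu.2 hv.2)

omit [CompleteSpace X] [CompleteSpace Y] in
lemma resolvent_opB_nonempty {f : X → EReal} {g : Y → ℝ}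
    (hf : ∀ x, (resolvent (subdifferential f) x).Nonempty)
    (hg : ∀ y, (resolvent (subdifferential (conjugate fun y => (g y : EReal))) y).Nonempty)
    (z : WithLp 2 (X × Y)) : (resolvent (opB f g) z).Nonempty := by
  obtain ⟨p, u, hu, hpu⟩ := hf z.fst
  obtain ⟨q, v, hv, hqv⟩ := hg z.snd
  exact ⟨WithLp.toLp 2 (p, q), WithLp.toLp 2 (u, v), ⟨hu, hv⟩,
    WithLp.ofLp_injective 2 (Prod.ext hpu hqv)⟩

end PrimalDual

end PrimalDualDR

theorem mainTheorem3
    {X Y : Type*} [NormedAddCommGroup X] [InnerProductSpace ℝ X] [CompleteSpace X]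
    [NormedAddCommGroup Y] [InnerProductSpace ℝ Y] [CompleteSpace Y]
    (L : X →L[ℝ] Y) (hL : L ≠ 0)
    (f : X → EReal) (σ : ℝ) (hσ : 0 < σ)
    (hf_proper : PrimalDualDR.IsProper f)
    (hf_closed : LowerSemicontinuous f)
    (hf_conv : PrimalDualDR.IsStronglyConvex σ f)
    (g : Y → ℝ) (β : ℝ) (hβ : 0 < β)
    (hg_conv : ConvexOn ℝ Set.univ g)
    (hg_diff : Differentiable ℝ g)
    (hg_lip : ∀ y y' : Y, ‖gradient g y - gradient g y'‖ ≤ β * ‖y - y'‖)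
    (μ : ℝ) (hμ : μ = min σ (1 / β))
    (r : ℝ) (hr : r = PrimalDualDR.rate ‖L‖ μ) :
    0 < r ∧ r < 1 ∧
    -- the resolvents are single-valued and everywhere defined, so they are maps `JA` and `JB`
    ∃ JA JB : WithLp 2 (X × Y) → WithLp 2 (X × Y),
      (∀ z, PrimalDualDR.resolvent (PrimalDualDR.opA L) z = {JA z}) ∧
      (∀ z, PrimalDualDR.resolvent (PrimalDualDR.opB f g) z = {JB z}) ∧
      ∃ RA RB T T' : WithLp 2 (X × Y) → WithLp 2 (X × Y),
        RA = PrimalDualDR.reflected JA ∧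
        RB = PrimalDualDR.reflected JB ∧
        T = PrimalDualDR.drOperator RB RA ∧
        T' = PrimalDualDR.drOperator RA RB ∧
        ∃ xbar xhat : WithLp 2 (X × Y),
          Function.fixedPoints T = {xbar} ∧
          Function.fixedPoints (RB ∘ RA) = {xbar} ∧
          Function.fixedPoints (RA ∘ RB) = {xhat} ∧
          Function.fixedPoints T' = {xhat} ∧
          PrimalDualDR.zerSum (PrimalDualDR.opA L) (PrimalDualDR.opB f g) = {JA xbar} ∧
          PrimalDualDR.zerSum (PrimalDualDR.opA L) (PrimalDualDR.opB f g) = {JB xhat} ∧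
          ∀ x₀ : WithLp 2 (X × Y),
            PrimalDualDR.ConvergesLinearly (fun n => T^[n] x₀) xbar r ‖x₀ - xbar‖ ∧
            PrimalDualDR.ConvergesLinearly (fun n => JA (T^[n] x₀)) (JA xbar) r ‖x₀ - xbar‖ ∧
            PrimalDualDR.ConvergesLinearly (fun n => T'^[n] x₀) xhat r ‖x₀ - xhat‖ ∧
            PrimalDualDR.ConvergesLinearly (fun n => JB (T'^[n] x₀)) (JB xhat) r ‖x₀ - xhat‖ := by
  have hμ0 : 0 < μ := by rw [hμ]; positivity
  have hB := PrimalDualDR.isStronglyMonotone_opB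
    ((hf_conv.isStronglyMonotone_subdifferential hf_proper).mono (hμ.trans_le (min_le_left _ _)))
    ((hg_conv.isStronglyMonotone_subdifferential_conjugate hg_diff hβ hg_lip).mono
      (hμ.trans_le (min_le_right _ _)))
  obtain ⟨JA, JB, hJA, hJB, xbar, xhat, h1, h2, h3, h4, h5⟩ :=
    PrimalDualDR.douglasRachford_linear_convergence (PrimalDualDR.inner_skewCLM_self L)
      (PrimalDualDR.norm_skewCLM_sq_le L) hμ0 hB
      (PrimalDualDR.resolvent_opB_nonempty
        (hf_conv.resolvent_subdifferential_nonempty hσ.le hf_proper hf_closed)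
        (hg_conv.resolvent_subdifferential_conjugate_nonempty hg_diff))
  rw [← PrimalDualDR.opA_eq_skewCLM] at hJA h3
  subst hr
  refine ⟨PrimalDualDR.rate_pos _ hμ0, PrimalDualDR.rate_lt_one _ hμ0, JA, JB, hJA, hJB,
    _, _, _, _, rfl, rfl, rfl, rfl, xbar, xhat, h1, ?_, ?_, h2, h3, ?_, h5⟩
  · rw [← PrimalDualDR.fixedPoints_drOperator, h1]
  · rw [← PrimalDualDR.fixedPoints_drOperator, h2]
  · rw [h3, h4]
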